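/- Let $d \ge 0$ and let $g = \widehat{\nabla U} : \mathbb{R}^d \to \mathbb{R}^d$ be the approximate gradient field (e.g. the output of a neural network) that replaces $\nabla U$ in Hamiltonian Monte Carlo. Volume means Lebesgue measure on the phase space $\mathbb{R}^d \times \mathbb{R}^d$ of pairs $(q,p)$. For $\epsilon \in \mathbb{R}$ let the leapfrog step $\Psi_\epsilon(q,p) = (q^+,p^+)$ be given by $$p^{1/2} = p - \tfrac{\epsilon}{2}\, g(q), \qquad q^+ = q + \epsilon\, p^{1/2}, \qquad p^+ = p^{1/2} - \tfrac{\epsilon}{2}\, g(q^+).$$ A shear map of phase space is a map of the form $(q,p) \mapsto (q, p + s(q))$ or $(q,p) \mapsto (q + s(p), p)$ for some $s:\mathbb{R}^d\to\mathbb{R}^d$. (1) Finite step size. For every $\epsilon \in \mathbb{R}$ and every number $L \ge 0$ of steps, $\Psi_\epsilon^L$ is a composition of shear maps. If $g$ is measurable, then $\Psi_\epsilon^L$ is a bijection of phase space that preserves volume. (2) Infinitesimal step size. Consider the system $q' = p$, $p' = -g(q)$. (a) Its vector field $v(q,p) = (p, -g(q))$ has zero divergence: at every point the partial derivatives $\partial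 v_{q_i}/\partial q_i$ and $\partial v_{p_i}/\partial p_i$ exist, and $\sum_{i=1}^d \big(\partial v_{q_i}/\partial q_i + \partial v_{p_i}/\partial p_i\big) = 0$. (b) If $g$ is locally Lipschitz, then the flow of the system preserves volume: for every $t \in \mathbb{R}$ and every measurable set $A$ of initial points from which solutions exist up to time $t$, the set of the points that the solutions starting in $A$ reach at time $t$ is measurable and has the same volume as $A$. In particular, if the flow is defined globally, then each of its time-$t$ maps is a volume-preserving bijection of phase space. (c) If $g$ is globally Lipschitz, then the system has exactly one global flow, i.e. for every initial point there is exactly one solution on all of $\mathbb{R}$. -/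

import Mathlib

open MeasureTheory

namespace NNgHMC

/-- Phase space `ℝᵈ × ℝᵈ` with points `(q, p)`; its `volume` is `2d`-dimensional Lebesgue
measure. -/
abbrev Phase (d : ℕ) : Type :=
  EuclideanSpace ℝ (Fin d) × EuclideanSpace ℝ (Fin d)

/-- One leapfrog step of size `ε`, with the approximate gradient `g` in place of `∇U`:
half a step in `p`, a full step in `q`, half a step in `p`. -/
noncomputable def leapfrogStep {d : ℕ}
    (g : EuclideanSpace ℝ (Fin d) → EuclideanSpace ℝ (Fin d)) (ε : ℝ) (z : Phase d) : Phase d :=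
  let pHalf := z.2 - (ε / 2) • g z.1
  let qNew := z.1 + ε • pHalf
  let pNew := pHalf - (ε / 2) • g qNew
  (qNew, pNew)

/-- A shear map of phase space: one of the two variables is kept and the other one is translated
by a vector that depends only on the variable kept. -/
def IsShear {d : ℕ} (T : Phase d → Phase d) : Prop :=
  (∃ s : EuclideanSpace ℝ (Fin d) → EuclideanSpace ℝ (Fin d), ∀ q p, T (q, p) = (q, p + s q)) ∨
  (∃ s : EuclideanSpace ℝ (Fin d) → EuclideanSpace ℝ (Fin d), ∀ q p, T (q, p) = (q + s p, p))

/-- The vector field of the system `q' = p`, `p' = -g(q)`. -/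
noncomputable def field {d : ℕ}
    (g : EuclideanSpace ℝ (Fin d) → EuclideanSpace ℝ (Fin d)) (z : Phase d) : Phase d :=
  (z.2, -g z.1)

/-- The partial derivatives `∂vᵢ/∂qᵢ` of the position components and `∂v_{d+i}/∂pᵢ` of the momentum
components of `v` exist at `z`, and their sum, the divergence of `v` at `z`, is `c`. -/
def HasDivergenceAt {d : ℕ} (v : Phase d → Phase d) (c : ℝ) (z : Phase d) : Prop :=
  ∃ a b : Fin d → ℝ,
    (∀ i, HasDerivAt
      (fun s : ℝ => (v (z.1 + s • EuclideanSpace.single i (1 : ℝ), z.2)).1 i) (a i) 0) ∧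
    (∀ i, HasDerivAt
      (fun s : ℝ => (v (z.1, z.2 + s • EuclideanSpace.single i (1 : ℝ))).2 i) (b i) 0) ∧
    ∑ i, (a i + b i) = c

/-- `γ` solves `z' = v(z)` on the closed time interval between `0` and `t` (`t` of either sign);
the derivatives at the two ends are one-sided. -/
def IsTrajectory {d : ℕ} (v : Phase d → Phase d) (t : ℝ) (γ : ℝ → Phase d) : Prop :=
  ∀ s ∈ Set.uIcc 0 t, HasDerivWithinAt γ (v (γ s)) (Set.uIcc 0 t) s

/-- The initial points from which a solution of `z' = v(z)` exists up to time `t`. -/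
def flowDomain {d : ℕ} (v : Phase d → Phase d) (t : ℝ) : Set (Phase d) :=
  {z | ∃ γ : ℝ → Phase d, γ 0 = z ∧ IsTrajectory v t γ}

/-- The points reached at time `t` by the solutions of `z' = v(z)` that start in `A` at time `0`. -/
def flowImage {d : ℕ} (v : Phase d → Phase d) (t : ℝ) (A : Set (Phase d)) : Set (Phase d) :=
  {w | ∃ γ : ℝ → Phase d, γ 0 ∈ A ∧ IsTrajectory v t γ ∧ γ t = w}

/-- `Φ` is a global flow of `z' = v(z)`: every `t ↦ Φ t z` is the solution, for all times, that
starts at `z`. -/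
def IsGlobalFlow {d : ℕ} (v : Phase d → Phase d) (Φ : ℝ → Phase d → Phase d) : Prop :=
  ∀ z, Φ 0 z = z ∧ ∀ t, HasDerivAt (fun s => Φ s z) (v (Φ t z)) t

end NNgHMC

/-! A leapfrog step is kick, drift, kick. Each factor is a shear, and a shear translates one
variable by an amount fixed by the other, so Fubini gives volume preservation for merely measurable
`g`. For the flow, zero divergence is not turned into a Jacobian identity, because a Lipschitz `g`
need not have a differentiable flow. Volume preservation is instead inherited from the leapfrog
method. For globally Lipschitz `g`, `n` steps of size `t / n` converge to the time-`t` map uniformly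
on bounded sets (`IsGlobalFlow.exists_dist_leapfrog_le`), so a compact `A` is carried into a
thickening of `Φ t '' A` by a map that preserves volume. This gives `volume A ≤ volume (Φ t '' A)`,
and the same bound at time `-t` gives equality. A locally Lipschitz `g` agrees on each ball with a
globally Lipschitz one. The trajectories that stay in the ball of radius `n` are thus covered, and
`n → ∞` exhausts the flow domain (`measurableSet_and_volume_flowImage`). -/

namespace NNgHMC

/-! ### Autonomous Lipschitz equations: uniqueness, dependence on initial values, global existence.
-/

section ODE

open Set Metric Filter Topology
open scoped NNReal

variable {E : Type*} [NormedAddCommGroup E] [NormedSpace ℝ E] {v : E → E} {K : ℝ≥0}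
  {γ γ' : ℝ → E}

/-- Two solutions of a Lipschitz equation with the same value at time `0` agree. -/
theorem eqOn_uIcc_of_isIntegralCurveOn (hv : LipschitzWith K v) {t : ℝ}
    (hγ : IsIntegralCurveOn γ (fun _ => v) (uIcc 0 t))
    (hγ' : IsIntegralCurveOn γ' (fun _ => v) (uIcc 0 t)) (h : γ 0 = γ' 0) :
    EqOn γ γ' (uIcc 0 t) := by
  rcases le_total 0 t with ht | ht
  · rw [uIcc_of_le ht] at *
    exact ODE_solution_unique_of_mem_Icc_right (s := fun _ => univ) (v := fun _ => v)
      (fun _ _ => hv.lipschitzOnWith) hγ.continuousOn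
      (fun s hs => (hγ s (Ico_subset_Icc_self hs)).mono_of_mem_nhdsWithin
        (Icc_mem_nhdsGE_of_mem hs)) (fun _ _ => trivial) hγ'.continuousOn
      (fun s hs => (hγ' s (Ico_subset_Icc_self hs)).mono_of_mem_nhdsWithin
        (Icc_mem_nhdsGE_of_mem hs)) (fun _ _ => trivial) h
  · rw [uIcc_of_ge ht] at *
    exact ODE_solution_unique_of_mem_Icc_left (s := fun _ => univ) (v := fun _ => v)
      (fun _ _ => hv.lipschitzOnWith) hγ.continuousOn
      (fun s hs => (hγ s (Ioc_subset_Icc_self hs)).mono_of_mem_nhdsWithin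
        (Icc_mem_nhdsLE_of_mem hs)) (fun _ _ => trivial) hγ'.continuousOn
      (fun s hs => (hγ' s (Ioc_subset_Icc_self hs)).mono_of_mem_nhdsWithin
        (Icc_mem_nhdsLE_of_mem hs)) (fun _ _ => trivial) h

theorem eq_of_isIntegralCurve (hv : LipschitzWith K v) (hγ : IsIntegralCurve γ (fun _ => v))
    (hγ' : IsIntegralCurve γ' (fun _ => v)) (h : γ 0 = γ' 0) : γ = γ' :=
  funext fun _ => eqOn_uIcc_of_isIntegralCurveOn hv (hγ.isIntegralCurveOn _)
    (hγ'.isIntegralCurveOn _) h right_mem_uIcc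

theorem dist_le_exp_of_isIntegralCurve_of_nonneg (hv : LipschitzWith K v)
    (hγ : IsIntegralCurve γ (fun _ => v)) (hγ' : IsIntegralCurve γ' (fun _ => v)) {t : ℝ}
    (ht : 0 ≤ t) : dist (γ t) (γ' t) ≤ dist (γ 0) (γ' 0) * Real.exp (K * t) := by
  simpa using dist_le_of_trajectories_ODE (v := fun _ => v) (a := 0) (b := t) (fun _ => hv)
    hγ.continuous.continuousOn (fun s _ => (hγ s).hasDerivWithinAt) hγ'.continuous.continuousOn
    (fun s _ => (hγ' s).hasDerivWithinAt) le_rfl t ⟨ht, le_rfl⟩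

theorem isIntegralCurve_comp_neg (hγ : IsIntegralCurve γ (fun _ => v)) :
    IsIntegralCurve (fun s => γ (-s)) (fun _ z => -v z) := fun s => by
  simpa [Function.comp_def] using (hγ (-s)).scomp s (hasDerivAt_neg s)

/-- Solutions of a Lipschitz equation depend on the initial value in a Lipschitz way. -/
theorem dist_le_exp_of_isIntegralCurve (hv : LipschitzWith K v)
    (hγ : IsIntegralCurve γ (fun _ => v)) (hγ' : IsIntegralCurve γ' (fun _ => v)) (t : ℝ) :
    dist (γ t) (γ' t) ≤ dist (γ 0) (γ' 0) * Real.exp (K * |t|) := by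
  rcases le_total 0 t with ht | ht
  · rw [abs_of_nonneg ht]
    exact dist_le_exp_of_isIntegralCurve_of_nonneg hv hγ hγ' ht
  · rw [abs_of_nonpos ht]
    simpa using dist_le_exp_of_isIntegralCurve_of_nonneg (v := fun z => -v z) hv.neg
      (isIntegralCurve_comp_neg hγ) (isIntegralCurve_comp_neg hγ') (neg_nonneg.2 ht)

/-- At the junction `b` both one-sided derivatives equal `v (γ b)`, so the glued curve is
differentiable there. -/
theorem isIntegralCurveOn_ite {a b c : ℝ} (hab : a ≤ b) (hbc : b ≤ c)
    (hγ : IsIntegralCurveOn γ (fun _ => v) (Icc a b))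
    (hγ' : IsIntegralCurveOn γ' (fun _ => v) (Icc b c)) (h : γ b = γ' b) :
    IsIntegralCurveOn (fun s => if s ≤ b then γ s else γ' s) (fun _ => v) (Icc a c) := by
  have h₁ : EqOn (fun s => if s ≤ b then γ s else γ' s) γ (Icc a b) := fun s hs => if_pos hs.2
  have h₂ : EqOn (fun s => if s ≤ b then γ s else γ' s) γ' (Icc b c) := fun s hs => by
    rcases hs.1.eq_or_lt with rfl | hs'
    · simpa using h
    · exact if_neg hs'.not_ge
  intro s hs
  rw [← Icc_union_Icc_eq_Icc hab hbc] at hs ⊢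
  refine HasDerivWithinAt.union ?_ ?_
  · by_cases hs₁ : s ∈ Icc a b
    · rw [h₁ hs₁]
      exact (hγ s hs₁).congr h₁ (h₁ hs₁)
    -- Off the closure of the set, the derivative within it is a vacuous condition.
    · exact HasFDerivWithinAt.of_notMem_closure ((closure_Icc a b).symm ▸ hs₁)
  · by_cases hs₂ : s ∈ Icc b c
    · rw [h₂ hs₂]
      exact (hγ' s hs₂).congr h₂ (h₂ hs₂)
    · exact HasFDerivWithinAt.of_notMem_closure ((closure_Icc b c).symm ▸ hs₂)

theorem isIntegralCurveOn_Icc_comp_sub {a b : ℝ} (hγ : IsIntegralCurveOn γ (fun _ => v) (Icc a b))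
    (c : ℝ) : IsIntegralCurveOn (fun s => γ (s - c)) (fun _ => v) (Icc (a + c) (b + c)) := by
  intro s hs
  have hmaps : MapsTo (fun s => s - c) (Icc (a + c) (b + c)) (Icc a b) :=
    fun r hr => ⟨by linarith [hr.1], by linarith [hr.2]⟩
  simpa [Function.comp_def] using (hγ (s - c) (hmaps hs)).scomp s
    ((hasDerivAt_id s).sub_const c).hasDerivWithinAt hmaps

/-- Since `T` is the same for all initial points, the solution can be restarted at both ends of its
interval. -/
theorem exists_isIntegralCurveOn_Icc_two_mul {T : ℝ} (hT : 0 ≤ T)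
    (h : ∀ z, ∃ γ : ℝ → E, γ 0 = z ∧ IsIntegralCurveOn γ (fun _ => v) (Icc (-T) T)) (z : E) :
    ∃ γ : ℝ → E, γ 0 = z ∧ IsIntegralCurveOn γ (fun _ => v) (Icc (-(2 * T)) (2 * T)) := by
  obtain ⟨γ, h0, hγ⟩ := h z
  obtain ⟨α, hα0, hα⟩ := h (γ T)
  obtain ⟨β, hβ0, hβ⟩ := h (γ (-T))
  have hα' := (isIntegralCurveOn_Icc_comp_sub hα T).mono
    (Icc_subset_Icc (show -T + T ≤ T by linarith) (show 2 * T ≤ T + T by linarith))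
  have hβ' := (isIntegralCurveOn_Icc_comp_sub hβ (-T)).mono
    (Icc_subset_Icc (show -T + -T ≤ -(2 * T) by linarith) (show -T ≤ T + -T by linarith))
  have h₁ := isIntegralCurveOn_ite (by linarith) (by linarith) hβ' hγ (by simpa using hβ0)
  have h₂ := isIntegralCurveOn_ite (by linarith) (by linarith) h₁ hα' (by
    rcases hT.eq_or_lt with rfl | hT
    · simpa [hα0] using hβ0
    · simp [hα0, show ¬ T ≤ -T by linarith])
  refine ⟨_, ?_, h₂⟩
  rcases hT.eq_or_lt with rfl | hT
  · simpa [h0] using hβ0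
  · simp [hT.le, hT.not_ge, h0]

variable [CompleteSpace E]

/-- The existence time does not depend on `z`: on the ball of radius `a = ‖v z‖ + 1` the speed is at
most `K * a + ‖v z‖ ≤ (1 + K) * a`, so leaving it takes time at least `(1 + K)⁻¹`. -/
theorem exists_isIntegralCurveOn_Icc_inv (hv : LipschitzWith K v) (z : E) :
    ∃ γ : ℝ → E, γ 0 = z ∧ IsIntegralCurveOn γ (fun _ => v) (Icc (-(1 + K : ℝ)⁻¹) (1 + K)⁻¹) := by
  have hK : (0 : ℝ) < (1 + K : ℝ)⁻¹ := by positivity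
  have : IsPicardLindelof (fun _ => v) (tmin := -(1 + K : ℝ)⁻¹) (tmax := (1 + K : ℝ)⁻¹)
      ⟨0, by constructor <;> linarith⟩ z (‖v z‖₊ + 1) 0 ((1 + K) * (‖v z‖₊ + 1)) K :=
    { lipschitzOnWith := fun _ _ => hv.lipschitzOnWith
      continuousOn := fun _ _ => continuousOn_const
      norm_le := fun _ _ x hx => by
        have h₁ := hv.dist_le_mul x z
        rw [mem_closedBall] at hx
        push_cast at hx ⊢
        rw [dist_eq_norm] at h₁
        have h₂ : ‖v x‖ ≤ ‖v x - v z‖ + ‖v z‖ := by simpa using norm_add_le (v x - v z) (v z)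
        have := mul_le_mul_of_nonneg_left hx K.coe_nonneg
        linarith
      mul_max_le := by
        simp only [sub_zero, zero_sub, neg_neg, max_self]
        push_cast
        field_simp
        simp }
  exact this.exists_eq_forall_mem_Icc_hasDerivWithinAt₀

theorem exists_isIntegralCurveOn_Icc (hv : LipschitzWith K v) (T : ℝ) (z : E) :
    ∃ γ : ℝ → E, γ 0 = z ∧ IsIntegralCurveOn γ (fun _ => v) (Icc (-T) T) := by
  have key : ∀ (n : ℕ) (z : E), ∃ γ : ℝ → E, γ 0 = z ∧
      IsIntegralCurveOn γ (fun _ => v) (Icc (-(2 ^ n * (1 + K : ℝ)⁻¹)) (2 ^ n * (1 + K : ℝ)⁻¹)) := by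
    intro n
    induction n with
    | zero => simpa using exists_isIntegralCurveOn_Icc_inv hv
    | succ n ih =>
      rw [pow_succ', mul_assoc]
      exact exists_isIntegralCurveOn_Icc_two_mul (by positivity) ih
  obtain ⟨n, hn⟩ := pow_unbounded_of_one_lt (T * (1 + K)) one_lt_two
  have : T ≤ 2 ^ n * (1 + K : ℝ)⁻¹ := by
    rw [← div_eq_mul_inv, le_div_iff₀ (by positivity)]
    exact hn.le
  obtain ⟨γ, h0, hγ⟩ := key n z
  exact ⟨γ, h0, hγ.mono (Icc_subset_Icc (neg_le_neg this) this)⟩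

/-- A globally Lipschitz vector field on a Banach space has solutions for all times. -/
theorem exists_isIntegralCurve (hv : LipschitzWith K v) (z : E) :
    ∃ γ : ℝ → E, γ 0 = z ∧ IsIntegralCurve γ (fun _ => v) := by
  choose γ h0 hγ using fun T : ℝ => exists_isIntegralCurveOn_Icc hv T z
  have hsub : ∀ {s T : ℝ}, |s| ≤ T → uIcc 0 s ⊆ Icc (-T) T := fun {s T} h => by
    have h' := abs_le.1 h
    have := (abs_nonneg s).trans h
    exact uIcc_subset_Icc ⟨by linarith, this⟩ h'
  have heq : ∀ {s T : ℝ}, |s| ≤ T → γ (|s| + 1) s = γ T s := fun {s T} h =>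
    eqOn_uIcc_of_isIntegralCurveOn hv ((hγ (|s| + 1)).mono (hsub (by linarith)))
      ((hγ T).mono (hsub h)) (by rw [h0, h0]) right_mem_uIcc
  -- The margin `1` makes `s` an interior point, so the derivative there is two-sided.
  refine ⟨fun s => γ (|s| + 1) s, h0 _, fun s => ?_⟩
  have hmem : Ioo (-(|s| + 1)) (|s| + 1) ∈ 𝓝 s := by
    have := abs_lt.1 (lt_add_one |s|)
    exact Ioo_mem_nhds this.1 this.2
  refine ((hγ (|s| + 1) s (abs_le.1 (lt_add_one |s|).le)).hasDerivAt
    (mem_of_superset hmem Ioo_subset_Icc_self)).congr_of_eventuallyEq ?_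
  filter_upwards [hmem] with r hr using heq (abs_le.2 ⟨hr.1.le, hr.2.le⟩)

end ODE

/-! ### Local and global errors of one-step methods. -/

section ConvergenceOfIterates

open Set

variable {E : Type*} [NormedAddCommGroup E] [NormedSpace ℝ E] {v : E → E} {K : NNReal}
  {γ : ℝ → E}

/-- The local error of the explicit Euler step is quadratic in the step size. -/
theorem norm_sub_sub_smul_le (hv : LipschitzWith K v) (hγ : IsIntegralCurve γ (fun _ => v))
    {a b M : ℝ} (hM : ∀ s ∈ uIcc a b, ‖v (γ s)‖ ≤ M) :
    ‖γ b - γ a - (b - a) • v (γ a)‖ ≤ K * M * |b - a| ^ 2 := by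
  have h₁ : ∀ s ∈ uIcc a b, ‖γ s - γ a‖ ≤ M * |b - a| := fun s hs => by
    refine ((convex_uIcc a b).norm_image_sub_le_of_norm_hasDerivWithin_le
      (fun r _ => (hγ r).hasDerivWithinAt) hM left_mem_uIcc hs).trans ?_
    have := (norm_nonneg _).trans (hM s hs)
    gcongr
    simpa [Real.norm_eq_abs] using abs_sub_left_of_mem_uIcc hs
  -- Mean value inequality for `γ s - s • v (γ a)`, whose derivative `v (γ s) - v (γ a)` is small by
  -- `h₁`.
  have h₂ := (convex_uIcc a b).norm_image_sub_le_of_norm_hasDerivWithin_le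
    (f := fun s => γ s - s • v (γ a)) (f' := fun s => v (γ s) - v (γ a)) (C := K * (M * |b - a|))
    (fun r _ => by
      simpa using ((hγ r).fun_sub ((hasDerivAt_id r).smul_const (v (γ a)))).hasDerivWithinAt)
    (fun s hs => (hv.norm_sub_le _ _).trans (by gcongr; exact h₁ s hs))
    left_mem_uIcc right_mem_uIcc
  rw [Real.norm_eq_abs] at h₂
  calc ‖γ b - γ a - (b - a) • v (γ a)‖ = ‖γ b - b • v (γ a) - (γ a - a • v (γ a))‖ := by
        congr 1; rw [sub_smul]; abel
    _ ≤ _ := h₂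
    _ = _ := by ring

/-- The global error of a one-step method is controlled by the sum of its local errors. -/
theorem dist_iterate_le {X : Type*} [PseudoMetricSpace X] {Ψ : X → X} {c δ : ℝ} (hc : 0 ≤ c)
    (hδ : 0 ≤ δ) (hΨ : ∀ x y, dist (Ψ x) (Ψ y) ≤ Real.exp c * dist x y) {u : ℕ → X} {n : ℕ}
    (hu : ∀ k < n, dist (u (k + 1)) (Ψ (u k)) ≤ δ) :
    dist (u n) (Ψ^[n] (u 0)) ≤ n * δ * Real.exp (c * n) := by
  induction n with
  | zero => simp
  | succ n ih =>
    rw [Function.iterate_succ_apply']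
    have hexp : 1 ≤ Real.exp (c * (n + 1)) := Real.one_le_exp (by positivity)
    calc dist (u (n + 1)) (Ψ (Ψ^[n] (u 0)))
        ≤ dist (u (n + 1)) (Ψ (u n)) + dist (Ψ (u n)) (Ψ (Ψ^[n] (u 0))) := dist_triangle _ _ _
      _ ≤ δ + Real.exp c * (n * δ * Real.exp (c * n)) := by
        gcongr
        · exact hu n (Nat.lt_succ_self n)
        · exact (hΨ _ _).trans (by gcongr; exact ih fun k hk => hu k (hk.trans n.lt_succ_self))
      _ = δ + n * δ * Real.exp (c * (n + 1)) := by
        rw [show c * ((n : ℝ) + 1) = c + c * n by ring, Real.exp_add]; ring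
      _ ≤ δ * Real.exp (c * (n + 1)) + n * δ * Real.exp (c * (n + 1)) := by
        gcongr; exact le_mul_of_one_le_right hδ hexp
      _ = ((n + 1 : ℕ) : ℝ) * δ * Real.exp (c * (n + 1 : ℕ)) := by push_cast; ring

end ConvergenceOfIterates

/-! ### The leapfrog step: shears, volume, stability, consistency. -/

section Leapfrog

variable {d : ℕ} {g : EuclideanSpace ℝ (Fin d) → EuclideanSpace ℝ (Fin d)}

/-- The half step in the momentum. -/
noncomputable def kick (g : EuclideanSpace ℝ (Fin d) → EuclideanSpace ℝ (Fin d)) (ε : ℝ)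
    (z : Phase d) : Phase d :=
  (z.1, z.2 - (ε / 2) • g z.1)

/-- The full step in the position. -/
noncomputable def drift (ε : ℝ) (z : Phase d) : Phase d :=
  (z.1 + ε • z.2, z.2)

theorem leapfrogStep_eq_comp (g : EuclideanSpace ℝ (Fin d) → EuclideanSpace ℝ (Fin d)) (ε : ℝ) :
    leapfrogStep g ε = kick g ε ∘ drift ε ∘ kick g ε :=
  rfl

theorem isShear_kick (g : EuclideanSpace ℝ (Fin d) → EuclideanSpace ℝ (Fin d)) (ε : ℝ) :
    IsShear (kick g ε) :=
  Or.inl ⟨fun q => -((ε / 2) • g q), fun q p => by simp [kick, sub_eq_add_neg]⟩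

theorem isShear_drift (ε : ℝ) : IsShear (drift ε : Phase d → Phase d) :=
  Or.inr ⟨fun p => ε • p, fun _ _ => rfl⟩

theorem exists_shears_eq_leapfrogStep_iterate
    (g : EuclideanSpace ℝ (Fin d) → EuclideanSpace ℝ (Fin d)) (ε : ℝ) (L : ℕ) :
    ∃ l : List (Phase d → Phase d), (∀ T ∈ l, IsShear T) ∧
      (leapfrogStep g ε)^[L] = l.foldr (fun T F => T ∘ F) id := by
  induction L with
  | zero => exact ⟨[], by simp, rfl⟩
  | succ L ih =>
    obtain ⟨l, hl, h⟩ := ih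
    refine ⟨kick g ε :: drift ε :: kick g ε :: l, ?_, ?_⟩
    · simpa [isShear_kick, isShear_drift] using hl
    · rw [Function.iterate_succ', h]
      rfl

theorem bijective_leapfrogStep (g : EuclideanSpace ℝ (Fin d) → EuclideanSpace ℝ (Fin d)) (ε : ℝ) :
    Function.Bijective (leapfrogStep g ε) := by
  have hk : Function.Bijective (kick g ε) := Function.bijective_iff_has_inverse.2
    ⟨kick g (-ε), fun z => by simp [kick, neg_div], fun z => by simp [kick, neg_div]⟩
  have hd : Function.Bijective (drift ε : Phase d → Phase d) := Function.bijective_iff_has_inverse.2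
    ⟨drift (-ε), fun z => by simp [drift], fun z => by simp [drift]⟩
  exact hk.comp (hd.comp hk)

/-- A measurable translation of the second variable that depends on the first one preserves
the product measure. -/
theorem measurePreserving_fst_snd_add {α G : Type*} [MeasurableSpace α] [MeasurableSpace G]
    [AddGroup G] [MeasurableAdd₂ G] (μ : Measure α) [SFinite μ] (ν : Measure G) [SFinite ν]
    [ν.IsAddRightInvariant] {s : α → G} (hs : Measurable s) :
    MeasurePreserving (fun z : α × G => (z.1, z.2 + s z.1)) (μ.prod ν) (μ.prod ν) :=
  (MeasurePreserving.id μ).skew_product (g := fun a x => x + s a)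
    (measurable_snd.add (hs.comp measurable_fst))
    (Filter.Eventually.of_forall fun a => map_add_right_eq_self ν (s a))

theorem measurePreserving_kick (hg : Measurable g) (ε : ℝ) :
    MeasurePreserving (kick g ε) volume volume := by
  have := measurePreserving_fst_snd_add volume volume (hg.const_smul (ε / 2)).neg
  simp only [Pi.neg_apply, ← sub_eq_add_neg] at this
  exact this

/-- Swapping `q` and `p` turns the drift into a shear of the second variable. -/
theorem measurePreserving_drift (ε : ℝ) :
    MeasurePreserving (drift ε : Phase d → Phase d) volume volume :=
  Measure.measurePreserving_swap.comp ((measurePreserving_fst_snd_add volume volume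
    (measurable_id.const_smul ε)).comp Measure.measurePreserving_swap)

theorem measurePreserving_leapfrogStep (hg : Measurable g) (ε : ℝ) :
    MeasurePreserving (leapfrogStep g ε) volume volume :=
  (measurePreserving_kick hg ε).comp ((measurePreserving_drift ε).comp (measurePreserving_kick hg ε))

/-- The exponential form makes the constants of `n` steps of size `t / n` multiply to a bound
independent of `n`. -/
theorem dist_kick_le {K : NNReal} (hg : LipschitzWith K g) (ε : ℝ) (x y : Phase d) :
    dist (kick g ε x) (kick g ε y) ≤ Real.exp (|ε| * (1 + K)) * dist x y := by
  have h₁ : dist x.1 y.1 ≤ dist x y := le_max_left _ _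
  have h₂ : dist x.2 y.2 ≤ dist x y := le_max_right _ _
  have hexp := Real.add_one_le_exp (|ε| * (1 + K))
  have hle : (1 + |ε| * (1 + K)) * dist x y ≤ Real.exp (|ε| * (1 + K)) * dist x y := by
    gcongr; linarith
  refine le_trans (max_le ?_ ?_) hle
  · exact h₁.trans (le_mul_of_one_le_left dist_nonneg (by linarith [show 0 ≤ |ε| * (1 + K) by positivity]))
  · refine (dist_sub_sub_le _ _ _ _).trans ?_
    rw [dist_smul₀, Real.norm_eq_abs, abs_div, abs_two]
    have h₃ : |ε| / 2 * dist (g x.1) (g y.1) ≤ |ε| * ((1 + K) * dist x y) := by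
      gcongr
      · linarith [abs_nonneg ε]
      · refine (hg.dist_le_mul _ _).trans ?_
        gcongr
        linarith
    linarith

theorem dist_drift_le (K : NNReal) (ε : ℝ) (x y : Phase d) :
    dist (drift ε x) (drift ε y) ≤ Real.exp (|ε| * (1 + K)) * dist x y := by
  have h₁ : dist x.1 y.1 ≤ dist x y := le_max_left _ _
  have h₂ : dist x.2 y.2 ≤ dist x y := le_max_right _ _
  have hexp := Real.add_one_le_exp (|ε| * (1 + K))
  have hle : (1 + |ε| * (1 + K)) * dist x y ≤ Real.exp (|ε| * (1 + K)) * dist x y := by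
    gcongr; linarith
  refine le_trans (max_le ?_ ?_) hle
  · refine (dist_add_add_le _ _ _ _).trans ?_
    rw [dist_smul₀, Real.norm_eq_abs]
    have h₃ : |ε| * dist x.2 y.2 ≤ |ε| * ((1 + K) * dist x y) := by
      gcongr
      exact h₂.trans (le_mul_of_one_le_left dist_nonneg (by linarith [K.coe_nonneg]))
    linarith
  · exact h₂.trans (le_mul_of_one_le_left dist_nonneg (by linarith [show 0 ≤ |ε| * (1 + K) by positivity]))

theorem dist_leapfrogStep_le {K : NNReal} (hg : LipschitzWith K g) (ε : ℝ) (x y : Phase d) :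
    dist (leapfrogStep g ε x) (leapfrogStep g ε y) ≤
      Real.exp (3 * (|ε| * (1 + K))) * dist x y := by
  set c := Real.exp (|ε| * (1 + K)) with hc
  have h₁ := dist_kick_le hg ε (drift ε (kick g ε x)) (drift ε (kick g ε y))
  have h₂ := dist_drift_le K ε (kick g ε x) (kick g ε y)
  have h₃ := dist_kick_le hg ε x y
  have hc0 : 0 ≤ c := (Real.exp_pos _).le
  have hc3 : Real.exp (3 * (|ε| * (1 + K))) = c ^ 3 := by
    rw [hc, ← Real.exp_nat_mul]; norm_num
  rw [hc3, leapfrogStep_eq_comp]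
  calc _ ≤ _ := h₁
    _ ≤ c * (c * (c * dist x y)) := by gcongr; exact h₂.trans (by gcongr)
    _ = _ := by ring

/-- The leapfrog step agrees with the explicit Euler step up to a quadratic error. -/
theorem norm_leapfrogStep_sub_le {K : NNReal} (hg : LipschitzWith K g) {ε T M : ℝ} (hε : |ε| ≤ T)
    {z : Phase d} (hM : ‖field g z‖ ≤ M) :
    ‖leapfrogStep g ε z - z - ε • field g z‖ ≤ (1 + K) * (1 + T) * M * |ε| ^ 2 := by
  have hp : ‖z.2‖ ≤ M := (norm_fst_le (field g z)).trans hM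
  have hq : ‖g z.1‖ ≤ M := by simpa [field] using (norm_snd_le (field g z)).trans hM
  have hM0 : 0 ≤ M := (norm_nonneg _).trans hp
  have hT : 0 ≤ T := (abs_nonneg _).trans hε
  have hK := K.coe_nonneg
  set w := z.1 + ε • (z.2 - (ε / 2) • g z.1) with hw
  refine max_le ?_ ?_
  -- The position error is explicit, already quadratic in `ε`.
  · have h : (leapfrogStep g ε z - z - ε • field g z).1 = -((ε ^ 2 / 2) • g z.1) := by
      simp only [leapfrogStep, field, Prod.fst_sub, Prod.smul_fst]
      module
    rw [h, norm_neg, norm_smul, Real.norm_eq_abs, abs_div, abs_two, abs_pow]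
    calc |ε| ^ 2 / 2 * ‖g z.1‖ ≤ |ε| ^ 2 * M := by
          gcongr; linarith [sq_nonneg |ε|]
      _ ≤ (1 + K) * (1 + T) * (|ε| ^ 2 * M) := by
          refine le_mul_of_one_le_left (by positivity) ?_
          nlinarith [mul_nonneg hK hT]
      _ = _ := by ring
  -- The momentum error gets its second factor `ε` from the Lipschitz bound on `g` along the
  -- position step.
  · have h : (leapfrogStep g ε z - z - ε • field g z).2 = (ε / 2) • (g z.1 - g w) := by
      simp only [leapfrogStep, field, Prod.snd_sub, Prod.smul_snd, ← hw]
      module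
    have hwz : ‖z.1 - w‖ ≤ |ε| * ((1 + T) * M) := by
      rw [hw, sub_add_cancel_left, norm_neg, norm_smul, Real.norm_eq_abs]
      gcongr
      refine (norm_sub_le _ _).trans ?_
      rw [norm_smul, Real.norm_eq_abs, abs_div, abs_two]
      have : |ε| / 2 * ‖g z.1‖ ≤ T * M := by gcongr; linarith [abs_nonneg ε]
      linarith
    rw [h, norm_smul, Real.norm_eq_abs, abs_div, abs_two]
    calc |ε| / 2 * ‖g z.1 - g w‖ ≤ |ε| * ((1 + K) * (|ε| * ((1 + T) * M))) := by
          gcongr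
          · linarith [abs_nonneg ε]
          · refine (hg.norm_sub_le _ _).trans ?_
            gcongr
            linarith
      _ = _ := by ring

theorem lipschitzWith_field {K : NNReal} (hg : LipschitzWith K g) :
    LipschitzWith (max 1 K) (field g) :=
  LipschitzWith.prodMk (f := Prod.snd) (g := fun z : Phase d => -g z.1) LipschitzWith.prod_snd
    (LipschitzWith.neg (f := fun z : Phase d => g z.1)
      (by simpa [Function.comp_def] using hg.comp LipschitzWith.prod_fst))

end Leapfrog

/-! ### The flow of the Hamiltonian-type field. -/

section Flow

open Set Filter Topology Metric

variable {d : ℕ} {g : EuclideanSpace ℝ (Fin d) → EuclideanSpace ℝ (Fin d)}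
  {Φ : ℝ → Phase d → Phase d}

theorem IsGlobalFlow.isIntegralCurve {v : Phase d → Phase d} (hΦ : IsGlobalFlow v Φ) (z : Phase d) :
    IsIntegralCurve (fun s => Φ s z) (fun _ => v) :=
  (hΦ z).2

theorem IsGlobalFlow.isTrajectory {v : Phase d → Phase d} (hΦ : IsGlobalFlow v Φ) (t : ℝ)
    (z : Phase d) : IsTrajectory v t (fun s => Φ s z) :=
  fun s _ => ((hΦ z).2 s).hasDerivWithinAt

theorem IsTrajectory.isIntegralCurveOn {v : Phase d → Phase d} {t : ℝ} {γ : ℝ → Phase d}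
    (hγ : IsTrajectory v t γ) : IsIntegralCurveOn γ (fun _ => v) (uIcc 0 t) :=
  hγ

theorem IsTrajectory.congr_field {v w : Phase d → Phase d} {t : ℝ} {γ : ℝ → Phase d}
    (hγ : IsTrajectory v t γ) (h : ∀ s ∈ uIcc 0 t, v (γ s) = w (γ s)) : IsTrajectory w t γ :=
  fun s hs => h s hs ▸ hγ s hs

theorem IsTrajectory.exists_forall_norm_le {v : Phase d → Phase d} {t : ℝ} {γ : ℝ → Phase d}
    (hγ : IsTrajectory v t γ) : ∃ n : ℕ, ∀ s ∈ uIcc 0 t, ‖γ s‖ ≤ n := by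
  obtain ⟨C, hC⟩ := isCompact_uIcc.exists_bound_of_continuousOn hγ.isIntegralCurveOn.continuousOn
  obtain ⟨n, hn⟩ := exists_nat_ge C
  exact ⟨n, fun s hs => (hC s hs).trans hn⟩

/-- A globally Lipschitz `g` generates exactly one global flow. -/
theorem existsUnique_isGlobalFlow {K : NNReal} (hg : LipschitzWith K g) :
    ∃! Φ : ℝ → Phase d → Phase d, IsGlobalFlow (field g) Φ := by
  choose γ h0 hγ using exists_isIntegralCurve (lipschitzWith_field hg)
  refine ⟨fun t z => γ z t, fun z => ⟨h0 z, hγ z⟩, fun Ψ hΨ => ?_⟩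
  ext1 t
  ext1 z
  exact congrFun (eq_of_isIntegralCurve (lipschitzWith_field hg) (hΨ.isIntegralCurve z) (hγ z)
    ((hΨ z).1.trans (h0 z).symm)) t

/-- On a ball, a locally Lipschitz field agrees with a globally Lipschitz one. -/
theorem exists_lipschitzWith_field_eq (hg : LocallyLipschitz g) (n : ℕ) :
    ∃ (K : NNReal) (g' : EuclideanSpace ℝ (Fin d) → EuclideanSpace ℝ (Fin d)),
      LipschitzWith K g' ∧ ∀ z : Phase d, ‖z‖ ≤ n → field g' z = field g z := by
  obtain ⟨K, hK⟩ := (hg.locallyLipschitzOn (s := closedBall 0 (n : ℝ))).exists_lipschitzOnWith_of_compact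
    (isCompact_closedBall _ _)
  obtain ⟨g', hg', heq⟩ := hK.extend_finite_dimension
  refine ⟨_, g', hg', fun z hz => ?_⟩
  rw [field, field, heq (mem_closedBall_zero_iff.2 ((norm_fst_le z).trans hz))]

theorem IsTrajectory.eqOn (hg : LocallyLipschitz g) {t : ℝ} {γ γ' : ℝ → Phase d}
    (hγ : IsTrajectory (field g) t γ) (hγ' : IsTrajectory (field g) t γ') (h : γ 0 = γ' 0) :
    EqOn γ γ' (uIcc 0 t) := by
  obtain ⟨n, hn⟩ := hγ.exists_forall_norm_le
  obtain ⟨m, hm⟩ := hγ'.exists_forall_norm_le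
  obtain ⟨K, g', hg', heq⟩ := exists_lipschitzWith_field_eq hg (max n m)
  exact eqOn_uIcc_of_isIntegralCurveOn (lipschitzWith_field hg')
    (hγ.congr_field fun s hs => (heq _ ((hn s hs).trans (by simp))).symm)
    (hγ'.congr_field fun s hs => (heq _ ((hm s hs).trans (by simp))).symm) h

/-- By uniqueness, `s ↦ Φ s (Φ t z)` and `s ↦ Φ (s + t) z` agree at `s = -t`. -/
theorem IsGlobalFlow.apply_neg_apply (hg : LocallyLipschitz g) (hΦ : IsGlobalFlow (field g) Φ)
    (t : ℝ) (z : Phase d) : Φ (-t) (Φ t z) = z := by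
  have hγ : IsTrajectory (field g) (-t) (fun s => Φ (s + t) z) := fun s _ => by
    simpa [Function.comp_def] using
      (((hΦ z).2 (s + t)).scomp s ((hasDerivAt_id s).add_const t)).hasDerivWithinAt
  have := (hΦ.isTrajectory (-t) (Φ t z)).eqOn hg hγ (by simp [(hΦ _).1])
    (right_mem_uIcc : -t ∈ uIcc 0 (-t))
  simpa [(hΦ z).1] using this

theorem IsGlobalFlow.apply_apply_neg (hg : LocallyLipschitz g) (hΦ : IsGlobalFlow (field g) Φ)
    (t : ℝ) (z : Phase d) : Φ t (Φ (-t) z) = z := by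
  simpa using hΦ.apply_neg_apply hg (-t) z

theorem IsGlobalFlow.bijective (hg : LocallyLipschitz g) (hΦ : IsGlobalFlow (field g) Φ) (t : ℝ) :
    Function.Bijective (Φ t) :=
  Function.bijective_iff_has_inverse.2 ⟨Φ (-t), hΦ.apply_neg_apply hg t, hΦ.apply_apply_neg hg t⟩

theorem IsGlobalFlow.image_eq_preimage (hg : LocallyLipschitz g) (hΦ : IsGlobalFlow (field g) Φ)
    (t : ℝ) (A : Set (Phase d)) : Φ t '' A = Φ (-t) ⁻¹' A :=
  congrFun (image_eq_preimage_of_inverse (hΦ.apply_neg_apply hg t) (hΦ.apply_apply_neg hg t)) A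

theorem IsGlobalFlow.dist_le {K : NNReal} (hg : LipschitzWith K g)
    (hΦ : IsGlobalFlow (field g) Φ) (t : ℝ) (x y : Phase d) :
    dist (Φ t x) (Φ t y) ≤ dist x y * Real.exp ((max 1 K : NNReal) * |t|) := by
  simpa [(hΦ _).1] using dist_le_exp_of_isIntegralCurve (lipschitzWith_field hg)
    (hΦ.isIntegralCurve x) (hΦ.isIntegralCurve y) t

theorem IsGlobalFlow.continuous {K : NNReal} (hg : LipschitzWith K g)
    (hΦ : IsGlobalFlow (field g) Φ) (t : ℝ) : Continuous (Φ t) :=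
  (LipschitzWith.of_dist_le_mul (K := ⟨_, (Real.exp_pos ((max 1 K : NNReal) * |t|)).le⟩)
    fun x y => (hΦ.dist_le hg t x y).trans_eq (mul_comm _ _)).continuous

/-- Lipschitz dependence compares every trajectory with the one from `0`, which is bounded on the
compact time interval. -/
theorem IsGlobalFlow.exists_norm_field_le {K : NNReal} (hg : LipschitzWith K g)
    (hΦ : IsGlobalFlow (field g) Φ) (t R : ℝ) :
    ∃ M, ∀ z : Phase d, ‖z‖ ≤ R → ∀ s ∈ uIcc 0 t, ‖field g (Φ s z)‖ ≤ M := by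
  obtain ⟨B, hB⟩ := isCompact_uIcc.exists_bound_of_continuousOn
    (hΦ.isIntegralCurve 0).continuous.continuousOn (s := uIcc 0 t)
  have hv := lipschitzWith_field hg
  refine ⟨‖field g 0‖ + (max 1 K : NNReal) * (B + R * Real.exp ((max 1 K : NNReal) * |t|)),
    fun z hz s hs => ?_⟩
  have hs' : |s| ≤ |t| := by simpa using abs_sub_left_of_mem_uIcc hs
  have h₁ : ‖Φ s z‖ ≤ B + R * Real.exp ((max 1 K : NNReal) * |t|) := by
    have h := hΦ.dist_le hg s z 0
    rw [dist_eq_norm, dist_zero_right] at h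
    have h' : ‖Φ s z‖ ≤ ‖Φ s 0‖ + ‖Φ s z - Φ s 0‖ := by
      simpa using norm_add_le (Φ s 0) (Φ s z - Φ s 0)
    refine h'.trans (add_le_add (hB s hs) (h.trans ?_))
    have := (norm_nonneg _).trans hz
    gcongr
  have h₂ : ‖field g (Φ s z)‖ ≤ ‖field g 0‖ + ‖field g (Φ s z) - field g 0‖ := by
    simpa using norm_add_le (field g 0) (field g (Φ s z) - field g 0)
  refine h₂.trans ?_
  gcongr
  refine (hv.norm_sub_le _ _).trans ?_
  rw [sub_zero]
  gcongr

/-! ### Volume preservation as a limit of the leapfrog method. -/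

/-- The leapfrog method converges to the flow, uniformly on bounded sets. -/
theorem IsGlobalFlow.exists_dist_leapfrog_le {K : NNReal} (hg : LipschitzWith K g)
    (hΦ : IsGlobalFlow (field g) Φ) (t R : ℝ) :
    ∃ C : ℝ, ∀ n : ℕ, 0 < n → ∀ z : Phase d, ‖z‖ ≤ R →
      dist (Φ t z) ((leapfrogStep g (t / n))^[n] z) ≤ C / n := by
  obtain ⟨M, hM⟩ := hΦ.exists_norm_field_le hg t R
  -- The two summands bound the distances of the exact flow and of the leapfrog step from the
  -- explicit Euler step.
  set D : ℝ := ((max 1 K : NNReal) + (1 + K) * (1 + |t|)) * M with hD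
  refine ⟨D * |t| ^ 2 * Real.exp (3 * (|t| * (1 + K))), fun n hn z hz => ?_⟩
  have hM0 : 0 ≤ M := (norm_nonneg _).trans (hM z hz 0 left_mem_uIcc)
  have hn' : (0 : ℝ) < n := by exact_mod_cast hn
  have hn1 : (1 : ℝ) ≤ n := by exact_mod_cast hn
  set h : ℝ := t / n with hh
  have habs : |h| = |t| / n := by rw [hh, abs_div, abs_of_pos hn']
  have hht : |h| ≤ |t| := by rw [habs]; exact div_le_self (abs_nonneg t) hn1
  have hmem : ∀ k : ℕ, k ≤ n → (k : ℝ) * h ∈ uIcc 0 t := fun k hk => by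
    have hkn : (k : ℝ) / n ∈ Icc (0 : ℝ) 1 :=
      ⟨by positivity, (div_le_one hn').2 (by exact_mod_cast hk)⟩
    have := (convex_uIcc (0 : ℝ) t).segment_subset left_mem_uIcc right_mem_uIcc
      (segment_eq_image' ℝ (0 : ℝ) t ▸ mem_image_of_mem _ hkn)
    simpa [hh, div_mul_eq_mul_div, mul_div_assoc] using this
  have hlocal : ∀ k < n, dist (Φ ((k + 1 : ℕ) * h) z) (leapfrogStep g h (Φ (k * h) z)) ≤
      D * |h| ^ 2 := fun k hk => by
    have h₁ := norm_sub_sub_smul_le (lipschitzWith_field hg) (hΦ.isIntegralCurve z)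
      (a := k * h) (b := (k + 1 : ℕ) * h) (M := M)
      fun s hs => hM z hz s (uIcc_subset_uIcc (hmem k hk.le) (hmem (k + 1) hk) hs)
    have h₂ := norm_leapfrogStep_sub_le hg hht (hM z hz _ (hmem k hk.le))
    rw [show ((k + 1 : ℕ) : ℝ) * h - k * h = h by push_cast; ring] at h₁
    rw [dist_eq_norm]
    calc ‖Φ ((k + 1 : ℕ) * h) z - leapfrogStep g h (Φ (k * h) z)‖
        = ‖(Φ ((k + 1 : ℕ) * h) z - Φ (k * h) z - h • field g (Φ (k * h) z)) -
          (leapfrogStep g h (Φ (k * h) z) - Φ (k * h) z - h • field g (Φ (k * h) z))‖ := by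
          congr 1; abel
      _ ≤ _ := norm_sub_le _ _
      _ ≤ _ := add_le_add h₁ h₂
      _ = D * |h| ^ 2 := by rw [hD]; ring
  -- There are `n` local errors `D * (|t| / n) ^ 2`, which leaves one factor `1 / n`.
  have key := dist_iterate_le (u := fun k : ℕ => Φ (k * h) z) (n := n) (by positivity)
    (by positivity) (dist_leapfrogStep_le hg h) hlocal
  simp only [Nat.cast_zero, zero_mul, (hΦ z).1] at key
  rw [show (n : ℝ) * h = t by rw [hh]; field_simp] at key
  refine key.trans_eq ?_
  rw [show 3 * (|h| * (1 + K)) * (n : ℝ) = 3 * (|t| * (1 + K)) by rw [habs]; field_simp, habs]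
  field_simp

/-- `A` lies in the preimage of the closed `C / n`-thickening of `Φ t '' A` under `n` leapfrog
steps, which has the volume of the thickening. As the image is compact, these volumes tend to its
own. -/
theorem IsGlobalFlow.volume_le_of_isCompact {K : NNReal} (hg : LipschitzWith K g)
    (hΦ : IsGlobalFlow (field g) Φ) (t : ℝ) {A : Set (Phase d)} (hA : IsCompact A) :
    volume A ≤ volume (Φ t '' A) := by
  obtain ⟨R, hR⟩ := hA.isBounded.exists_norm_le
  obtain ⟨C, hC⟩ := hΦ.exists_dist_leapfrog_le hg t R
  have hlim : Tendsto (fun n : ℕ => volume (cthickening (C / n) (Φ t '' A))) atTop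
      (𝓝 (volume (Φ t '' A))) :=
    (tendsto_measure_cthickening_of_isCompact (hA.image (hΦ.continuous hg t))).comp
      (tendsto_const_div_atTop_nhds_zero_nat C)
  refine ge_of_tendsto hlim ?_
  filter_upwards [eventually_gt_atTop 0] with n hn
  have hmp := (measurePreserving_leapfrogStep hg.continuous.measurable (t / n)).iterate n
  rw [← hmp.measure_preimage isClosed_cthickening.measurableSet.nullMeasurableSet]
  refine measure_mono fun z hz => mem_cthickening_of_dist_le _ (Φ t z) _ _ (mem_image_of_mem _ hz) ?_
  rw [dist_comm]
  exact hC n hn z (hR z hz)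

theorem IsGlobalFlow.volume_le {K : NNReal} (hg : LipschitzWith K g)
    (hΦ : IsGlobalFlow (field g) Φ) (t : ℝ) {A : Set (Phase d)} (hA : MeasurableSet A) :
    volume A ≤ volume (Φ t '' A) := by
  have : SigmaFinite (volume : Measure (Phase d)) := inferInstance
  have : (volume : Measure (Phase d)).InnerRegularCompactLTTop := inferInstance
  rw [hA.measure_eq_iSup_isCompact]
  exact iSup₂_le fun F hF => iSup_le fun hFc =>
    (hΦ.volume_le_of_isCompact hg t hFc).trans (measure_mono (image_mono hF))

/-- **Liouville's theorem** for the flow of a globally Lipschitz `g`. -/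
theorem IsGlobalFlow.measurableSet_image_and_volume_image {K : NNReal} (hg : LipschitzWith K g)
    (hΦ : IsGlobalFlow (field g) Φ) (t : ℝ) {A : Set (Phase d)} (hA : MeasurableSet A) :
    MeasurableSet (Φ t '' A) ∧ volume (Φ t '' A) = volume A := by
  have hm : MeasurableSet (Φ t '' A) := by
    rw [hΦ.image_eq_preimage hg.locallyLipschitz]
    exact (hΦ.continuous hg (-t)).measurable hA
  refine ⟨hm, le_antisymm ?_ (hΦ.volume_le hg t hA)⟩
  -- The reverse inequality is the same bound for the backward flow, applied to the image.
  refine (hΦ.volume_le hg (-t) hm).trans_eq ?_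
  rw [image_image]
  simp [hΦ.apply_neg_apply hg.locallyLipschitz]

/-! ### Local flows, exhausted by the trajectories in balls. -/

/-- The initial points whose solutions exist up to time `t` and have norm at most `r` until then. -/
def boundedFlowDomain (v : Phase d → Phase d) (t r : ℝ) : Set (Phase d) :=
  {z | ∃ γ : ℝ → Phase d, γ 0 = z ∧ IsTrajectory v t γ ∧ ∀ s ∈ uIcc 0 t, ‖γ s‖ ≤ r}

theorem flowDomain_eq_iUnion (v : Phase d → Phase d) (t : ℝ) :
    flowDomain v t = ⋃ n : ℕ, boundedFlowDomain v t n := by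
  ext z
  simp only [mem_iUnion]
  constructor
  · rintro ⟨γ, h0, hγ⟩
    obtain ⟨n, hn⟩ := hγ.exists_forall_norm_le
    exact ⟨n, γ, h0, hγ, hn⟩
  · rintro ⟨n, γ, h0, hγ, -⟩
    exact ⟨γ, h0, hγ⟩

theorem boundedFlowDomain_mono (v : Phase d → Phase d) (t : ℝ) :
    Monotone (boundedFlowDomain v t) := by
  rintro r r' h z ⟨γ, h0, hγ, hr⟩
  exact ⟨γ, h0, hγ, fun s hs => (hr s hs).trans h⟩

theorem flowImage_mono (v : Phase d → Phase d) (t : ℝ) : Monotone (flowImage v t) := by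
  rintro A B h w ⟨γ, h0, hγ, hw⟩
  exact ⟨γ, h h0, hγ, hw⟩

theorem flowImage_iUnion {ι : Sort*} (v : Phase d → Phase d) (t : ℝ) (A : ι → Set (Phase d)) :
    flowImage v t (⋃ i, A i) = ⋃ i, flowImage v t (A i) := by
  ext w
  simp only [mem_iUnion, flowImage, mem_ofPred_eq]
  grind

/-- Trajectories within the ball of radius `n` do not see the change from `g` to a globally
Lipschitz `g'`, so the flow image is an image under the global flow of `g'`. -/
theorem measurableSet_and_volume_flowImage_inter (hg : LocallyLipschitz g) (t : ℝ) (n : ℕ)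
    {A : Set (Phase d)} (hA : MeasurableSet A) :
    MeasurableSet (A ∩ boundedFlowDomain (field g) t n) ∧
    MeasurableSet (flowImage (field g) t (A ∩ boundedFlowDomain (field g) t n)) ∧
    volume (flowImage (field g) t (A ∩ boundedFlowDomain (field g) t n)) =
      volume (A ∩ boundedFlowDomain (field g) t n) := by
  obtain ⟨K, g', hg', heq⟩ := exists_lipschitzWith_field_eq hg n
  obtain ⟨Φ, hΦ, -⟩ := existsUnique_isGlobalFlow hg'
  have htraj : ∀ z, (∀ s ∈ uIcc 0 t, ‖Φ s z‖ ≤ n) →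
      IsTrajectory (field g) t (fun s => Φ s z) := fun z hz =>
    (hΦ.isTrajectory t z).congr_field fun s hs => heq _ (hz s hs)
  have hbdd : ∀ z ∈ boundedFlowDomain (field g) t n, ∀ s ∈ uIcc 0 t, ‖Φ s z‖ ≤ n := by
    rintro z ⟨γ, h0, hγ, hn⟩ s hs
    have h := (hΦ.isTrajectory t z).eqOn hg'.locallyLipschitz
      (hγ.congr_field fun s hs => (heq _ (hn s hs)).symm) ((hΦ z).1.trans h0.symm) hs
    exact (congrArg norm h).trans_le (hn s hs)
  -- An intersection of closed sets, hence closed, although over uncountably many times.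
  have hD : boundedFlowDomain (field g) t n = ⋂ s ∈ uIcc 0 t, Φ s ⁻¹' closedBall 0 n := by
    ext z
    simp only [mem_iInter, mem_preimage, mem_closedBall_zero_iff]
    exact ⟨hbdd z, fun hz => ⟨fun s => Φ s z, (hΦ z).1, htraj z hz, hz⟩⟩
  have hm : MeasurableSet (A ∩ boundedFlowDomain (field g) t n) := by
    rw [hD]
    exact hA.inter (isClosed_biInter fun s _ =>
      isClosed_closedBall.preimage (hΦ.continuous hg' s)).measurableSet
  have himage : flowImage (field g) t (A ∩ boundedFlowDomain (field g) t n) =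
      Φ t '' (A ∩ boundedFlowDomain (field g) t n) := by
    ext w
    constructor
    · rintro ⟨γ, h0, hγ, rfl⟩
      exact ⟨γ 0, h0, (htraj _ (hbdd _ h0.2)).eqOn hg hγ (hΦ _).1 right_mem_uIcc⟩
    · rintro ⟨z, hz, rfl⟩
      exact ⟨fun s => Φ s z, by simpa only [(hΦ z).1] using hz, htraj z (hbdd z hz.2), rfl⟩
  rw [himage]
  exact ⟨hm, hΦ.measurableSet_image_and_volume_image hg' t hm⟩

/-- **Liouville's theorem** for the local flow of a locally Lipschitz `g`. -/
theorem measurableSet_and_volume_flowImage (hg : LocallyLipschitz g) (t : ℝ)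
    {A : Set (Phase d)} (hA : MeasurableSet A) (hAt : A ⊆ flowDomain (field g) t) :
    MeasurableSet (flowImage (field g) t A) ∧ volume (flowImage (field g) t A) = volume A := by
  set B : ℕ → Set (Phase d) := fun n => A ∩ boundedFlowDomain (field g) t n with hB
  have hAB : A = ⋃ n, B n := by
    rw [hB, ← inter_iUnion, ← flowDomain_eq_iUnion, inter_eq_left.2 hAt]
  have hmono : Monotone B := fun m n h =>
    inter_subset_inter_right A (boundedFlowDomain_mono _ t (Nat.cast_le.2 h))
  have key := fun n => measurableSet_and_volume_flowImage_inter hg t n hA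
  rw [hAB, flowImage_iUnion]
  refine ⟨MeasurableSet.iUnion fun n => (key n).2.1, ?_⟩
  rw [Monotone.measure_iUnion fun _ _ h => flowImage_mono (field g) t (hmono h),
    hmono.measure_iUnion]
  exact iSup_congr fun n => (key n).2.2

theorem IsGlobalFlow.flowImage_eq (hg : LocallyLipschitz g) (hΦ : IsGlobalFlow (field g) Φ)
    (t : ℝ) (A : Set (Phase d)) : flowImage (field g) t A = Φ t '' A := by
  ext w
  constructor
  · rintro ⟨γ, h0, hγ, rfl⟩
    exact ⟨γ 0, h0, (hΦ.isTrajectory t _).eqOn hg hγ (hΦ _).1 right_mem_uIcc⟩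
  · rintro ⟨z, hz, rfl⟩
    exact ⟨fun s => Φ s z, by simpa only [(hΦ z).1] using hz, hΦ.isTrajectory t z, rfl⟩

theorem IsGlobalFlow.measurePreserving (hg : LocallyLipschitz g)
    (hΦ : IsGlobalFlow (field g) Φ) (t : ℝ) : MeasurePreserving (Φ t) volume volume := by
  have key : ∀ A, MeasurableSet A →
      MeasurableSet (Φ t ⁻¹' A) ∧ volume (Φ t ⁻¹' A) = volume A := fun A hA => by
    have himage := hΦ.image_eq_preimage hg (-t) A
    rw [neg_neg] at himage
    rw [← himage, ← hΦ.flowImage_eq hg]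
    exact measurableSet_and_volume_flowImage hg (-t) hA
      fun z _ => ⟨fun s => Φ s z, (hΦ z).1, hΦ.isTrajectory (-t) z⟩
  have hmeas : Measurable (Φ t) := fun A hA => (key A hA).1
  exact ⟨hmeas, Measure.ext fun A hA => by rw [Measure.map_apply hmeas hA, (key A hA).2]⟩

/-- The position components do not involve `q` and the momentum components do not involve `p`, so
every partial derivative is that of a constant, whatever `g` is. -/
theorem hasDivergenceAt_field (g : EuclideanSpace ℝ (Fin d) → EuclideanSpace ℝ (Fin d))
    (z : Phase d) : HasDivergenceAt (field g) 0 z :=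
  ⟨0, 0, fun i => hasDerivAt_const 0 (z.2 i), fun i => hasDerivAt_const 0 ((-g z.1) i), by simp⟩

end Flow

end NNgHMC

theorem lemma1 (d : ℕ) (g : EuclideanSpace ℝ (Fin d) → EuclideanSpace ℝ (Fin d)) :
    -- finite step sizes: any number `L` of leapfrog steps of any size `ε`
    (∀ (ε : ℝ) (L : ℕ),
      (∃ l : List (NNgHMC.Phase d → NNgHMC.Phase d), (∀ T ∈ l, NNgHMC.IsShear T) ∧
        (NNgHMC.leapfrogStep g ε)^[L] = l.foldr (fun T F => T ∘ F) id) ∧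
      (Measurable g →
        Function.Bijective (NNgHMC.leapfrogStep g ε)^[L] ∧
        MeasurePreserving (NNgHMC.leapfrogStep g ε)^[L] volume volume)) ∧
    -- infinitesimal step sizes: the vector field has zero divergence
    (∀ z : NNgHMC.Phase d, NNgHMC.HasDivergenceAt (NNgHMC.field g) 0 z) ∧
    -- its flow preserves volume, where and as long as it is defined
    (LocallyLipschitz g →
      (∀ (t : ℝ) (A : Set (NNgHMC.Phase d)), MeasurableSet A →
        A ⊆ NNgHMC.flowDomain (NNgHMC.field g) t →
        MeasurableSet (NNgHMC.flowImage (NNgHMC.field g) t A) ∧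
        volume (NNgHMC.flowImage (NNgHMC.field g) t A) = volume A) ∧
      (∀ Φ : ℝ → NNgHMC.Phase d → NNgHMC.Phase d, NNgHMC.IsGlobalFlow (NNgHMC.field g) Φ →
        ∀ t : ℝ, Function.Bijective (Φ t) ∧ MeasurePreserving (Φ t) volume volume)) ∧
    -- the flow is defined for all times if `g` is globally Lipschitz
    ((∃ K : NNReal, LipschitzWith K g) →
      ∃! Φ : ℝ → NNgHMC.Phase d → NNgHMC.Phase d, NNgHMC.IsGlobalFlow (NNgHMC.field g) Φ) := by
  refine ⟨fun ε L => ⟨NNgHMC.exists_shears_eq_leapfrogStep_iterate g ε L, fun hg =>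
    ⟨(NNgHMC.bijective_leapfrogStep g ε).iterate L,
      (NNgHMC.measurePreserving_leapfrogStep hg ε).iterate L⟩⟩,
    NNgHMC.hasDivergenceAt_field g,
    fun hg => ⟨fun t _ hA hAt => NNgHMC.measurableSet_and_volume_flowImage hg t hA hAt,
      fun _ hΦ t => ⟨hΦ.bijective hg t, hΦ.measurePreserving hg t⟩⟩,
    fun ⟨_, hg⟩ => NNgHMC.existsUnique_isGlobalFlow hg⟩
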